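/- Let $n \ge 2$, let $\sigma_{n-1}$ be the uniform (rotation invariant) probability measure on the unit sphere $S^{n-1} \subset \mathbf{R}^n$, and let $f$ be a real-valued function which is defined and $C^2$-smooth in some open neighbourhood $G$ of $S^{n-1}$. Denote by $\nabla f$ the Euclidean gradient of $f$, by $f'' = (\partial_{ij} f)_{i,j=1}^n$ its Euclidean Hessian matrix, and by $\|A\|_{\rm HS} = \big(\sum_{i,j} a_{ij}^2\big)^{1/2}$ the Hilbert–Schmidt norm of a matrix. If $f$ is orthogonal to all linear functions in $L^2(S^{n-1},\sigma_{n-1})$, that is, $\int f(\theta)\,\langle v,\theta\rangle\, d\sigma_{n-1}(\theta) = 0$ for all $v \in \mathbf{R}^n$, then $$ \int |\nabla f|^2\, d\sigma_{n-1} \;\le\; \frac{5}{n-1} \int \|f''\|_{\rm HS}^2\, d\sigma_{n-1}. $$ Moreover, the constant $5$ may be asymptotically improved to $2$: under the same assumptions, $$ \int |\nabla f|^2\, d\sigma_{n-1} \;\le\; \frac{c_n}{n-1} \int \|f''\|_{\rm HS}^2\, d\sigma_{n-1}, \qquad c_n = 1 + \Big(1 + \frac{1}{\sqrt{n-1}}\Big)^2,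 $$ where $c_n \to 2$ as $n \to \infty$. -/

import Mathlib

open MeasureTheory Filter Topology

-- Matrices carry the Hilbert-Schmidt (Frobenius) norm `‖A‖ = (∑ i, ∑ j, |A i j| ^ 2) ^ (1 / 2)`.
attribute [local instance] Matrix.frobeniusNormedAddCommGroup

/-- The uniform probability measure on the unit sphere of `ℝⁿ`: the surface measure induced by
Lebesgue measure, divided by its total mass. -/
noncomputable def sphereUniform (n : ℕ) :
    Measure (Metric.sphere (0 : EuclideanSpace ℝ (Fin n)) 1) :=
  ((volume : Measure (EuclideanSpace ℝ (Fin n))).toSphere Set.univ)⁻¹ •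
    (volume : Measure (EuclideanSpace ℝ (Fin n))).toSphere

theorem isProbabilityMeasure_sphereUniform (n : ℕ) (hn : 1 ≤ n) :
    IsProbabilityMeasure (sphereUniform n) := by
  have : Nonempty (Fin n) := ⟨⟨0, hn⟩⟩
  refine ⟨?_⟩
  rw [sphereUniform, Measure.smul_apply, smul_eq_mul]
  refine ENNReal.inv_mul_cancel ?_ (measure_ne_top _ _)
  rw [Ne, Measure.measure_univ_eq_zero]
  exact Measure.toSphere_ne_zero _

/-- The Euclidean Hessian: the matrix of second partial derivatives `∂ᵢ∂ⱼ f` at `x`. -/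
noncomputable def hessianMatrix {n : ℕ} (f : EuclideanSpace ℝ (Fin n) → ℝ)
    (x : EuclideanSpace ℝ (Fin n)) : Matrix (Fin n) (Fin n) ℝ :=
  Matrix.of fun i j =>
    fderiv ℝ (fun y => fderiv ℝ f y (EuclideanSpace.single j 1)) x (EuclideanSpace.single i 1)

/-- The dimension-dependent constant `cₙ = 1 + (1 + 1 / √(n - 1))²`. -/
noncomputable def gradientConst (n : ℕ) : ℝ :=
  1 + (1 + 1 / √((n : ℝ) - 1)) ^ 2

/-!
Let `a` be the mean of `∇f` over the sphere, so that
`∫ ‖∇f‖ ^ 2 = ∫ ‖∇f - a‖ ^ 2 + ‖a‖ ^ 2`.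

The first term is the sum of the variances of the partial derivatives of `f`, and a Poincaré
inequality on the sphere bounds it by the Hessian. Since `cₙ` tends to `2` and not to `1`, the sharp
constant `1 / (n - 1)` is not needed, and an elementary argument gives
`Var g ≤ (π ^ 2 / 8) * (1 + 1 / n) / (n - 1) * ∫ ‖∇g‖ ^ 2` (`integral_sub_average_sq_le`). Join a
random point `z` to a fixed point `p` by a great circle arc of length `α`, rotate the picture by a
Haar random rotation, and write the difference of `g` at the end points as the integral of its
derivative. At each time the rotated velocity is a uniformly random unit tangent vector at a
uniformly random point, so the mean square of the derivative is at most
`∫ ‖∇g‖ ^ 2 / (n - 1)` (`mul_integral_haar_inner_sq_le`), and the mean square of the difference is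
at most `α ^ 2` times this. It remains that `α ^ 2` has mean at most `(π ^ 2 / 4) * (1 + 1 / n)`
(`integral_arccos_inner_sq_le`).

For the second term, orthogonality to linear functions is differentiated along rotations, which
shows that the tangential part of `∇f` has mean zero (`integral_inner_gradient_eq`). Hence `a` is
the mean of `⟪∇f, θ⟫ θ`, and this yields `(n - 1) * ‖a‖ ^ 2 ≤ ∫ ‖∇f - a‖ ^ 2`
(`norm_sq_integral_gradient_le`).

Together the constant is `(1 + 1 / (n - 1)) * (π ^ 2 / 8) * (1 + 1 / n) / (n - 1)`, and the
numerator is at most `cₙ ≤ 5`.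
-/

open Metric

/-! ### The orthogonal group acting on the sphere -/

section Rotations

variable {V : Type*} [NormedAddCommGroup V] [InnerProductSpace ℝ V] [FiniteDimensional ℝ V]

/-- The action of the orthogonal group on the unit sphere. The orthogonal group is encoded as
`unitary (V →L[ℝ] V)`, which carries the operator norm topology and is a compact group. -/
def rotateSphere (U : unitary (V →L[ℝ] V)) (x : sphere (0 : V) 1) : sphere (0 : V) 1 :=
  ⟨(U : V →L[ℝ] V) x, by simp [Unitary.norm_map]⟩

@[simp]
theorem coe_rotateSphere (U : unitary (V →L[ℝ] V)) (x : sphere (0 : V) 1) :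
    (rotateSphere U x : V) = (U : V →L[ℝ] V) x := rfl

theorem rotateSphere_mul (U W : unitary (V →L[ℝ] V)) (x : sphere (0 : V) 1) :
    rotateSphere (U * W) x = rotateSphere U (rotateSphere W x) := rfl

theorem continuous_rotateSphere_uncurry :
    Continuous fun q : unitary (V →L[ℝ] V) × sphere (0 : V) 1 => rotateSphere q.1 q.2 := by
  refine Continuous.subtype_mk ?_ _
  fun_prop

theorem continuous_rotateSphere (U : unitary (V →L[ℝ] V)) : Continuous (rotateSphere U) :=
  continuous_rotateSphere_uncurry.comp (by fun_prop : Continuous fun x => (U, x))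

theorem continuous_rotateSphere_left (x : sphere (0 : V) 1) :
    Continuous fun U : unitary (V →L[ℝ] V) => rotateSphere U x :=
  continuous_rotateSphere_uncurry.comp (by fun_prop : Continuous fun U => (U, x))

/-- Orthogonal maps act transitively on vectors of a given norm, even when everything orthogonal
to both vectors is to be fixed: the reflection in the bisecting hyperplane does this. -/
theorem exists_unitary_map_eq {x y : V} (h : ‖x‖ = ‖y‖) :
    ∃ U : unitary (V →L[ℝ] V), (U : V →L[ℝ] V) x = y ∧
      ∀ w, inner ℝ w x = 0 → inner ℝ w y = 0 → (U : V →L[ℝ] V) w = w := by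
  refine ⟨Unitary.linearIsometryEquiv.symm (ℝ ∙ (x - y))ᗮ.reflection, ?_, fun w hx hy => ?_⟩
  · exact Submodule.reflection_sub h
  · refine Submodule.reflection_mem_subspace_eq_self ?_
    rw [Submodule.mem_orthogonal_singleton_iff_inner_left, inner_sub_right, hx, hy, sub_zero]

instance compactSpace_unitary : CompactSpace (unitary (V →L[ℝ] V)) := by
  refine isCompact_iff_compactSpace (s := (unitary (V →L[ℝ] V) : Set (V →L[ℝ] V))).1 ?_
  refine Metric.isCompact_of_isClosed_isBounded isClosed_unitary ?_
  refine (Metric.isBounded_closedBall (x := (0 : V →L[ℝ] V)) (r := 1)).subset fun U hU => ?_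
  rw [mem_closedBall_zero_iff]
  exact ContinuousLinearMap.opNorm_le_bound _ zero_le_one fun x => by
    rw [one_mul]; exact (Unitary.norm_map ⟨U, hU⟩ x).le

/-- The inverse of the left Haar measure is right invariant, so unimodularity of compact groups is
not needed. -/
theorem exists_rightInvariant_probabilityMeasure (G : Type*) [Group G] [TopologicalSpace G]
    [IsTopologicalGroup G] [CompactSpace G] [MeasurableSpace G] [BorelSpace G] :
    ∃ ν : Measure G, IsProbabilityMeasure ν ∧ ν.IsMulRightInvariant := by
  let μ : Measure G := (Measure.haarMeasure ⊤).inv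
  have h1 : IsProbabilityMeasure (Measure.haarMeasure (⊤ : TopologicalSpace.PositiveCompacts G)) :=
    ⟨by simpa using Measure.haarMeasure_self (K₀ := (⊤ : TopologicalSpace.PositiveCompacts G))⟩
  refine ⟨μ, ?_, inferInstance⟩
  exact Measure.isProbabilityMeasure_map measurable_inv.aemeasurable

end Rotations

/-! ### Rotation invariance of the surface measure -/

section Invariance

variable {V : Type*} [NormedAddCommGroup V] [InnerProductSpace ℝ V] [FiniteDimensional ℝ V]
  [MeasurableSpace V] [BorelSpace V]

open scoped Pointwise in
/-- The surface measure of a set on the sphere is, up to a factor, the volume of the cone over it,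
and orthogonal maps preserve cones and volume. -/
theorem measurePreserving_rotateSphere_toSphere (U : unitary (V →L[ℝ] V)) :
    MeasurePreserving (rotateSphere U) (volume : Measure V).toSphere
      (volume : Measure V).toSphere := by
  have hmeas : Measurable (rotateSphere U) := (continuous_rotateSphere U).measurable
  refine ⟨hmeas, Measure.ext fun s hs => ?_⟩
  rw [Measure.map_apply hmeas hs, Measure.toSphere_apply' _ hs,
    Measure.toSphere_apply' _ (hmeas hs)]
  congr 1
  have hU := (Unitary.linearIsometryEquiv U).measurePreserving
  refine (congrArg _ ?_).trans (hU.measure_preimage_equiv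
    (f := (Unitary.linearIsometryEquiv U).toMeasurableEquiv) (Set.Ioo (0 : ℝ) 1 • ((↑) '' s)))
  ext x
  simp only [Set.mem_smul, Set.mem_image, Set.mem_preimage]
  constructor
  · rintro ⟨r, hr, _, ⟨y, hy, rfl⟩, rfl⟩
    exact ⟨r, hr, _, ⟨rotateSphere U y, hy, rfl⟩, ((U : V →L[ℝ] V).map_smul r y).symm⟩
  · rintro ⟨r, hr, _, ⟨y, hy, rfl⟩, h⟩
    have hUy : rotateSphere U (rotateSphere U⁻¹ y) = y := by
      rw [← rotateSphere_mul, mul_inv_cancel]; rfl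
    refine ⟨r, hr, _, ⟨rotateSphere U⁻¹ y, by rwa [hUy], rfl⟩, ?_⟩
    refine (Unitary.linearIsometryEquiv U).injective (Eq.trans ?_ h)
    refine ((U : V →L[ℝ] V).map_smul r _).trans ?_
    exact congrArg (fun w : sphere (0 : V) 1 => r • (w : V)) hUy

end Invariance

/-! ### Haar averages over the orthogonal group -/

section Averages

variable {V : Type*} [NormedAddCommGroup V] [InnerProductSpace ℝ V] [FiniteDimensional ℝ V]
  [MeasurableSpace V] [BorelSpace V]

theorem integral_rotateSphere_eq {σ : Measure (sphere (0 : V) 1)} [IsProbabilityMeasure σ]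
    (hσ : ∀ U : unitary (V →L[ℝ] V), MeasurePreserving (rotateSphere U) σ σ)
    {h : sphere (0 : V) 1 → ℝ} (hh : Continuous h) (U : unitary (V →L[ℝ] V)) :
    ∫ x, h (rotateSphere U x) ∂σ = ∫ x, h x ∂σ := by
  conv_rhs => rw [← (hσ U).map_eq]
  exact (integral_map (hσ U).measurable.aemeasurable hh.aestronglyMeasurable).symm

/-- A Haar random rotation of a fixed point is uniformly distributed on the sphere. -/
theorem integral_haar_rotateSphere {σ : Measure (sphere (0 : V) 1)} [IsProbabilityMeasure σ]
    (hσ : ∀ U : unitary (V →L[ℝ] V), MeasurePreserving (rotateSphere U) σ σ)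
    (ν : Measure (unitary (V →L[ℝ] V))) [IsProbabilityMeasure ν] [ν.IsMulRightInvariant]
    {h : sphere (0 : V) 1 → ℝ} (hh : Continuous h) (p : sphere (0 : V) 1) :
    ∫ U, h (rotateSphere U p) ∂ν = ∫ x, h x ∂σ := by
  have hconst : ∀ q : sphere (0 : V) 1,
      ∫ U, h (rotateSphere U q) ∂ν = ∫ U, h (rotateSphere U p) ∂ν := by
    intro q
    obtain ⟨W, hW, -⟩ := exists_unitary_map_eq (x := (p : V)) (y := q) (by simp)
    have hWq : rotateSphere W p = q := Subtype.ext hW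
    rw [← integral_mul_right_eq_self (μ := ν) (fun U => h (rotateSphere U p)) W]
    simp only [rotateSphere_mul, hWq]
  have hint : Integrable (Function.uncurry fun (q : sphere (0 : V) 1) (U : unitary (V →L[ℝ] V)) =>
      h (rotateSphere U q)) (σ.prod ν) := by
    refine Continuous.integrable_of_hasCompactSupport ?_ (HasCompactSupport.of_compactSpace _)
    exact hh.comp (continuous_rotateSphere_uncurry.comp continuous_swap)
  calc ∫ U, h (rotateSphere U p) ∂ν
      = ∫ q, ∫ U, h (rotateSphere U q) ∂ν ∂σ := by simp [hconst]
    _ = ∫ U, ∫ q, h (rotateSphere U q) ∂σ ∂ν := integral_integral_swap hint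
    _ = ∫ x, h x ∂σ := by simp [integral_rotateSphere_eq hσ hh]

/-- For an orthonormal pair `(p, q)` and a vector field `X`, the component of `X` at a random
rotation of `p` along the rotated `q` carries in mean square at most the share `1 / (n - 1)` of
`∫ ‖X‖ ^ 2`: all `n - 1` tangential directions are equivalent, and the normal one only adds. -/
theorem mul_integral_haar_inner_sq_le {σ : Measure (sphere (0 : V) 1)} [IsProbabilityMeasure σ]
    (hσ : ∀ U : unitary (V →L[ℝ] V), MeasurePreserving (rotateSphere U) σ σ)
    (ν : Measure (unitary (V →L[ℝ] V))) [IsProbabilityMeasure ν] [ν.IsMulRightInvariant]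
    {X : sphere (0 : V) 1 → V} (hX : Continuous X) (p : sphere (0 : V) 1) {q : V}
    (hq : ‖q‖ = 1) (hpq : inner ℝ (p : V) q = 0) :
    ((Module.finrank ℝ V : ℝ) - 1) *
        ∫ U, (inner ℝ (X (rotateSphere U p)) ((U : V →L[ℝ] V) q)) ^ 2 ∂ν
      ≤ ∫ x, ‖X x‖ ^ 2 ∂σ := by
  set M : V → ℝ := fun w => ∫ U, (inner ℝ (X (rotateSphere U p)) ((U : V →L[ℝ] V) w)) ^ 2 ∂ν
  have hcont : ∀ w : V, Continuous fun U : unitary (V →L[ℝ] V) =>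
      (inner ℝ (X (rotateSphere U p)) ((U : V →L[ℝ] V) w)) ^ 2 := fun w =>
    ((hX.comp (continuous_rotateSphere_left p)).inner (by fun_prop)).pow 2
  have hint : ∀ w : V, Integrable (fun U : unitary (V →L[ℝ] V) =>
      (inner ℝ (X (rotateSphere U p)) ((U : V →L[ℝ] V) w)) ^ 2) ν := fun w =>
    (hcont w).integrable_of_hasCompactSupport (HasCompactSupport.of_compactSpace _)
  -- A reflection fixing `p` exchanges any two unit vectors orthogonal to `p`.
  have hM : ∀ w : V, ‖w‖ = 1 → inner ℝ (p : V) w = 0 → M w = M q := by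
    intro w hw hpw
    obtain ⟨W, hW, hfix⟩ := exists_unitary_map_eq (x := q) (y := w) (by rw [hq, hw])
    have hWp : rotateSphere W p = p := Subtype.ext (hfix _ hpq hpw)
    have := integral_mul_right_eq_self (μ := ν)
      (fun U => (inner ℝ (X (rotateSphere U p)) ((U : V →L[ℝ] V) q)) ^ 2) W
    rw [show M q = _ from this.symm]
    refine integral_congr_ae (Eventually.of_forall fun U => ?_)
    simp only [rotateSphere_mul, hWp]
    rw [← hW]
    rfl
  classical
  have hp0 : Orthonormal ℝ (({(p : V)} : Set V).domRestrict id) := by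
    constructor
    · rintro ⟨i, rfl⟩; simp
    · rintro ⟨i, rfl⟩ ⟨j, rfl⟩ hij; exact absurd rfl hij
  have hp1 : Orthonormal ℝ ((↑) : ({(p : V)} : Set V) → V) := hp0
  obtain ⟨u, b, hu, hb⟩ := hp1.exists_orthonormalBasis_extension
  let i₀ : u := ⟨p, hu rfl⟩
  have hi₀ : b i₀ = p := by rw [hb]
  have hsum : ∑ i, M (b i) = ∫ x, ‖X x‖ ^ 2 ∂σ := by
    rw [← integral_haar_rotateSphere hσ ν (h := fun x => ‖X x‖ ^ 2) (by fun_prop) p,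
      ← integral_finsetSum _ fun i _ => hint (b i)]
    refine integral_congr_ae (Eventually.of_forall fun U => ?_)
    have := (b.map (Unitary.linearIsometryEquiv U)).sum_sq_inner_left (X (rotateSphere U p))
    simpa using! this
  have hcard : Module.finrank ℝ V = Fintype.card u := Module.finrank_eq_card_basis b.toBasis
  rw [← hsum, ← Finset.add_sum_erase _ _ (Finset.mem_univ i₀)]
  have herase : ∑ i ∈ Finset.univ.erase i₀, M (b i) = ((Module.finrank ℝ V : ℝ) - 1) * M q := by
    rw [Finset.sum_congr rfl fun i hi => hM (b i) (b.orthonormal.1 i) ?_, Finset.sum_const,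
      Finset.card_erase_of_mem (Finset.mem_univ _), Finset.card_univ, ← hcard, nsmul_eq_mul,
      Nat.cast_sub, Nat.cast_one]
    · rw [hcard]; exact Fintype.card_pos_iff.2 ⟨i₀⟩
    · rw [← hi₀]
      exact b.orthonormal.2 (Finset.ne_of_mem_erase hi).symm
  rw [herase]
  have : 0 ≤ M (b i₀) := integral_nonneg fun U => sq_nonneg _
  linarith

/-- By invariance the second moment in direction `v` depends only on `‖v‖`, and the second moments
along an orthonormal basis add up to `1`. -/
theorem integral_inner_sq_sphere {σ : Measure (sphere (0 : V) 1)} [IsProbabilityMeasure σ]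
    (hσ : ∀ U : unitary (V →L[ℝ] V), MeasurePreserving (rotateSphere U) σ σ) (v : V) :
    ∫ x : sphere (0 : V) 1, (inner ℝ v (x : V)) ^ 2 ∂σ = ‖v‖ ^ 2 / Module.finrank ℝ V := by
  have hcont : ∀ w : V, Continuous fun x : sphere (0 : V) 1 => (inner ℝ w (x : V)) ^ 2 :=
    fun w => by fun_prop
  have hinv : ∀ w : V, ‖v‖ = ‖w‖ → ∫ x : sphere (0 : V) 1, (inner ℝ w (x : V)) ^ 2 ∂σ =
      ∫ x : sphere (0 : V) 1, (inner ℝ v (x : V)) ^ 2 ∂σ := by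
    intro w hw
    obtain ⟨W, hW, -⟩ := exists_unitary_map_eq hw
    rw [← integral_rotateSphere_eq hσ (hcont w) W]
    simp only [coe_rotateSphere, ← hW, Unitary.inner_map_map]
  let b := stdOrthonormalBasis ℝ V
  have hsum : ∑ i, ∫ x : sphere (0 : V) 1, (inner ℝ (‖v‖ • b i) (x : V)) ^ 2 ∂σ = ‖v‖ ^ 2 := by
    rw [← integral_finsetSum _ fun i _ => (hcont _).integrable_of_hasCompactSupport
      (HasCompactSupport.of_compactSpace _)]
    have : ∀ x : sphere (0 : V) 1, ∑ i, (inner ℝ (‖v‖ • b i) (x : V)) ^ 2 = ‖v‖ ^ 2 := by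
      intro x
      simp only [inner_smul_left, mul_pow, ← Finset.mul_sum, b.sum_sq_inner_right]
      simp
    simp [this]
  rw [Finset.sum_congr rfl fun i _ => hinv (‖v‖ • b i) (by simp [norm_smul]), Finset.sum_const,
    Finset.card_univ, Fintype.card_fin, nsmul_eq_mul] at hsum
  obtain ⟨x⟩ : Nonempty (sphere (0 : V) 1) := nonempty_of_isProbabilityMeasure σ
  have : Nontrivial V := ⟨x, 0, by
    intro h; have := norm_eq_of_mem_sphere x; simp [h] at this⟩
  have : (0 : ℝ) < Module.finrank ℝ V := by exact_mod_cast Module.finrank_pos (R := ℝ) (M := V)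
  rw [eq_div_iff this.ne', mul_comm, hsum]

/-- Bound for the mean square of the spherical distance to `p`. Averaging over `x` and `-x` turns
`arccos t ^ 2` into `π ^ 2 / 4 + arcsin t ^ 2`, and Jordan's inequality gives
`|arcsin t| ≤ (π / 2) * |t|`. -/
theorem integral_arccos_inner_sq_le {σ : Measure (sphere (0 : V) 1)} [IsProbabilityMeasure σ]
    (hσ : ∀ U : unitary (V →L[ℝ] V), MeasurePreserving (rotateSphere U) σ σ)
    (p : sphere (0 : V) 1) :
    ∫ x : sphere (0 : V) 1, Real.arccos (inner ℝ (p : V) (x : V)) ^ 2 ∂σ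
      ≤ Real.pi ^ 2 / 4 * (1 + 1 / Module.finrank ℝ V) := by
  have hc : Continuous fun x : sphere (0 : V) 1 => Real.arccos (inner ℝ (p : V) (x : V)) ^ 2 :=
    (Real.continuous_arccos.comp (by fun_prop)).pow 2
  have hc' : Continuous fun x : sphere (0 : V) 1 => Real.arccos (-inner ℝ (p : V) (x : V)) ^ 2 :=
    (Real.continuous_arccos.comp (by fun_prop)).pow 2
  have hi := hc.integrable_of_hasCompactSupport (μ := σ) (HasCompactSupport.of_compactSpace _)
  have hi' := hc'.integrable_of_hasCompactSupport (μ := σ) (HasCompactSupport.of_compactSpace _)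
  have hsymm : ∫ x : sphere (0 : V) 1, Real.arccos (-inner ℝ (p : V) (x : V)) ^ 2 ∂σ =
      ∫ x : sphere (0 : V) 1, Real.arccos (inner ℝ (p : V) (x : V)) ^ 2 ∂σ := by
    rw [← integral_rotateSphere_eq hσ hc (-1)]
    refine integral_congr_ae (Eventually.of_forall fun x => ?_)
    simp only [coe_rotateSphere]
    rw [← inner_neg_right]
    rfl
  have hpt : ∀ x : sphere (0 : V) 1, Real.arccos (inner ℝ (p : V) (x : V)) ^ 2 +
      Real.arccos (-inner ℝ (p : V) (x : V)) ^ 2 ≤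
      2 * (Real.pi ^ 2 / 4) + 2 * (Real.pi ^ 2 / 4) * (inner ℝ (p : V) (x : V)) ^ 2 := by
    intro x
    set t : ℝ := inner ℝ (p : V) (x : V)
    have ht : |t| ≤ 1 := by
      simpa using abs_real_inner_le_norm (p : V) (x : V)
    have hle : |Real.arcsin t| ≤ Real.pi / 2 * |t| := by
      have h1 : |Real.arcsin t| ≤ Real.pi / 2 :=
        abs_le.2 ⟨Real.neg_pi_div_two_le_arcsin t, Real.arcsin_le_pi_div_two t⟩
      have h2 := Real.mul_abs_le_abs_sin h1
      rw [Real.sin_arcsin (abs_le.1 ht).1 (abs_le.1 ht).2] at h2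
      have hpi := Real.pi_pos
      calc |Real.arcsin t| = Real.pi / 2 * (2 / Real.pi * |Real.arcsin t|) := by field_simp
        _ ≤ _ := by gcongr
    have hsq : Real.arcsin t ^ 2 ≤ (Real.pi / 2) ^ 2 * t ^ 2 := by
      rw [← sq_abs, ← sq_abs t, ← mul_pow]
      gcongr
    rw [Real.arccos_neg, Real.arccos]
    nlinarith
  have hq : Integrable (fun x : sphere (0 : V) 1 => (inner ℝ (p : V) (x : V)) ^ 2) σ :=
    Continuous.integrable_of_hasCompactSupport (by fun_prop) (HasCompactSupport.of_compactSpace _)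
  have := integral_mono (hi.add hi') ((integrable_const _).add (hq.const_mul _)) hpt
  rw [integral_add' hi hi', hsymm, integral_add' (integrable_const _) (hq.const_mul _),] at this
  simp only [integral_const_mul, integral_inner_sq_sphere hσ, integral_const, probReal_univ,
    one_smul, norm_eq_of_mem_sphere, one_pow] at this
  linarith

end Averages

/-! ### Great circles and the Poincaré inequality on the sphere -/

/-- Cauchy–Schwarz inequality against the constant function `1`. -/
theorem sq_intervalIntegral_le {φ : ℝ → ℝ} (hφ : Continuous φ) {a : ℝ} (ha : 0 ≤ a) :
    (∫ s in 0..a, φ s) ^ 2 ≤ a * ∫ s in 0..a, φ s ^ 2 := by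
  set I := ∫ s in 0..a, φ s
  rcases ha.eq_or_lt with rfl | ha'
  · simp [I]
  have h0 : 0 ≤ ∫ s in 0..a, (a * φ s - I) ^ 2 :=
    intervalIntegral.integral_nonneg ha fun s _ => sq_nonneg _
  have h1 : ∫ s in 0..a, (a * φ s - I) ^ 2 =
      ∫ s in 0..a, (a ^ 2 * φ s ^ 2 - 2 * a * I * φ s + I ^ 2) := by
    congr 1; ext s; ring
  rw [h1, intervalIntegral.integral_add, intervalIntegral.integral_sub,
    intervalIntegral.integral_const_mul, intervalIntegral.integral_const_mul,
    intervalIntegral.integral_const] at h0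
  · have : 0 ≤ a * (a * (∫ s in 0..a, φ s ^ 2) - I ^ 2) := by
      refine h0.trans_eq ?_
      simp only [sub_zero, smul_eq_mul]
      ring
    linarith [nonneg_of_mul_nonneg_right this ha']
  all_goals exact Continuous.intervalIntegrable (by fun_prop) _ _

section Geodesics

variable {V : Type*} [NormedAddCommGroup V] [InnerProductSpace ℝ V]

/-- The unit speed great circle that starts at `p` in the direction `q`, for an orthonormal pair
`(p, q)`. Its velocity is the same curve advanced by a quarter turn. -/
noncomputable def greatCircle (p q : V) (s : ℝ) : V := Real.cos s • p + Real.sin s • q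

theorem norm_greatCircle {p q : V} (hp : ‖p‖ = 1) (hq : ‖q‖ = 1) (hpq : inner ℝ p q = 0)
    (s : ℝ) : ‖greatCircle p q s‖ = 1 := by
  rw [← sq_eq_sq₀ (norm_nonneg _) zero_le_one, greatCircle, norm_add_sq_real, norm_smul, norm_smul,
    inner_smul_left, inner_smul_right, hpq, hp, hq]
  simp

theorem inner_greatCircle_add_pi_div_two {p q : V} (hp : ‖p‖ = 1) (hq : ‖q‖ = 1)
    (hpq : inner ℝ p q = 0) (s : ℝ) :
    inner ℝ (greatCircle p q s) (greatCircle p q (s + Real.pi / 2)) = 0 := by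
  have hqp : inner ℝ q p = 0 := by rw [real_inner_comm, hpq]
  simp [greatCircle, inner_add_left, inner_add_right, inner_smul_left, inner_smul_right, hpq, hqp,
    hp, hq, Real.cos_add_pi_div_two, Real.sin_add_pi_div_two]
  ring

theorem hasDerivAt_greatCircle (p q : V) (s : ℝ) :
    HasDerivAt (greatCircle p q) (greatCircle p q (s + Real.pi / 2)) s := by
  simpa [greatCircle, Real.cos_add_pi_div_two, Real.sin_add_pi_div_two] using!
    ((Real.hasDerivAt_cos s).smul_const p).add ((Real.hasDerivAt_sin s).smul_const q)

theorem continuous_greatCircle (p q : V) : Continuous (greatCircle p q) := by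
  unfold greatCircle; fun_prop

variable [FiniteDimensional ℝ V]

theorem exists_greatCircle_arccos_eq (hV : 2 ≤ Module.finrank ℝ V) {p z : V} (hp : ‖p‖ = 1)
    (hz : ‖z‖ = 1) : ∃ q : V, ‖q‖ = 1 ∧ inner ℝ p q = 0 ∧
      greatCircle p q (Real.arccos (inner ℝ p z)) = z := by
  set t : ℝ := inner ℝ p z with ht_def
  have ht : |t| ≤ 1 := by simpa [hp, hz] using abs_real_inner_le_norm p z
  have hcos : Real.cos (Real.arccos t) = t := Real.cos_arccos (abs_le.1 ht).1 (abs_le.1 ht).2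
  set w := z - t • p with hw
  have hpw : inner ℝ p w = 0 := by
    simp [hw, inner_sub_right, inner_smul_right, hp, ← ht_def]
  have hzw : z = t • p + w := by rw [hw]; abel
  have hnorm : ‖w‖ = √(1 - t ^ 2) := by
    rw [eq_comm, Real.sqrt_eq_iff_mul_self_eq (by nlinarith [sq_abs t, abs_nonneg t])
      (norm_nonneg _)]
    have := norm_add_sq_real (t • p) w
    rw [← hzw, hz, norm_smul, hp, inner_smul_left, hpw, Real.norm_eq_abs, mul_one, sq_abs] at this
    simp only [mul_zero, add_zero] at this
    linarith
  by_cases h0 : w = 0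
  -- If `z = ± p`, any unit vector orthogonal to `p` serves as direction.
  · have : Nontrivial (ℝ ∙ p)ᗮ := by
      have hp0 : p ≠ 0 := by rintro rfl; simp at hp
      have h1 := (ℝ ∙ p).finrank_add_finrank_orthogonal
      rw [finrank_span_singleton hp0] at h1
      exact Module.nontrivial_of_finrank_pos (R := ℝ) (by omega)
    obtain ⟨⟨q, hq⟩, hq1⟩ := exists_norm_eq (ℝ ∙ p)ᗮ zero_le_one
    refine ⟨q, hq1, Submodule.mem_orthogonal_singleton_iff_inner_right.1 hq, ?_⟩
    rw [greatCircle, hcos, Real.sin_arccos, ← hnorm, h0, hzw, h0]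
    simp
  · refine ⟨‖w‖⁻¹ • w, norm_smul_inv_norm h0, by rw [inner_smul_right, hpw, mul_zero], ?_⟩
    rw [greatCircle, hcos, Real.sin_arccos, ← hnorm, smul_smul,
      mul_inv_cancel₀ (norm_ne_zero_iff.2 h0), one_smul, ← hzw]

theorem continuous_gradient_sphere {G : Set V} (hG : IsOpen G) (hSG : sphere (0 : V) 1 ⊆ G)
    {g : V → ℝ} (hg : ContDiffOn ℝ 1 g G) :
    Continuous fun x : sphere (0 : V) 1 => gradient g (x : V) := by
  have h1 : ContinuousOn (fderiv ℝ g) G := hg.continuousOn_fderiv_of_isOpen hG le_rfl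
  have h2 : Continuous fun x : sphere (0 : V) 1 => fderiv ℝ g (x : V) :=
    h1.comp_continuous continuous_subtype_val fun x => hSG x.2
  exact (InnerProductSpace.toDual ℝ V).symm.continuous.comp h2

variable [MeasurableSpace V] [BorelSpace V]

/-- For a `C¹` function `g`, the mean square of `g (U z) - g (U p)` over random rotations `U` is at
most the squared spherical distance of `p` and `z` times `∫ ‖∇g‖ ^ 2 / (n - 1)`. The difference is
the integral of the derivative of `g` along the rotated minimal great circle arc, and
`mul_integral_haar_inner_sq_le` bounds the mean square of this derivative at each time. -/
theorem integral_haar_sub_sq_le {σ : Measure (sphere (0 : V) 1)} [IsProbabilityMeasure σ]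
    (hσ : ∀ U : unitary (V →L[ℝ] V), MeasurePreserving (rotateSphere U) σ σ)
    (ν : Measure (unitary (V →L[ℝ] V))) [IsProbabilityMeasure ν] [ν.IsMulRightInvariant]
    (hV : 2 ≤ Module.finrank ℝ V)
    {G : Set V} (hG : IsOpen G) (hSG : sphere (0 : V) 1 ⊆ G)
    {g : V → ℝ} (hg : ContDiffOn ℝ 1 g G) (p z : sphere (0 : V) 1) :
    ∫ U, (g (rotateSphere U z) - g (rotateSphere U p)) ^ 2 ∂ν
      ≤ Real.arccos (inner ℝ (p : V) (z : V)) ^ 2 *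
        ((∫ x : sphere (0 : V) 1, ‖gradient g (x : V)‖ ^ 2 ∂σ) /
          ((Module.finrank ℝ V : ℝ) - 1)) := by
  have hp1 : ‖(p : V)‖ = 1 := norm_eq_of_mem_sphere p
  obtain ⟨q, hq, hpq, hγz⟩ := exists_greatCircle_arccos_eq hV hp1 (norm_eq_of_mem_sphere z)
  set α := Real.arccos (inner ℝ (p : V) (z : V))
  have hα : 0 ≤ α := Real.arccos_nonneg _
  let γ : ℝ → sphere (0 : V) 1 := fun s =>
    ⟨greatCircle p q s, mem_sphere_zero_iff_norm.2 (norm_greatCircle hp1 hq hpq s)⟩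
  have hγc : Continuous γ := (continuous_greatCircle (p : V) q).subtype_mk _
  have hX := continuous_gradient_sphere hG hSG hg
  let φ : unitary (V →L[ℝ] V) → ℝ → ℝ := fun U s =>
    inner ℝ (gradient g (rotateSphere U (γ s))) ((U : V →L[ℝ] V) (γ (s + Real.pi / 2)))
  have hφ : Continuous (Function.uncurry φ) := by
    refine (hX.comp (continuous_rotateSphere_uncurry.comp
      (continuous_fst.prodMk (hγc.comp continuous_snd)))).inner ?_
    exact continuous_subtype_val.comp (continuous_rotateSphere_uncurry.comp
      (continuous_fst.prodMk (hγc.comp (by fun_prop))))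
  have hφU : ∀ U, Continuous (φ U) := fun U => hφ.comp (by fun_prop : Continuous fun s => (U, s))
  have hderiv : ∀ U s, HasDerivAt (fun s => g (rotateSphere U (γ s))) (φ U s) s := by
    intro U s
    have h1 : HasDerivAt (fun s => (U : V →L[ℝ] V) (greatCircle p q s))
        ((U : V →L[ℝ] V) (greatCircle p q (s + Real.pi / 2))) s :=
      (U : V →L[ℝ] V).hasFDerivAt.comp_hasDerivAt s (hasDerivAt_greatCircle (p : V) q s)
    have h2 : HasFDerivAt g (fderiv ℝ g (rotateSphere U (γ s))) (rotateSphere U (γ s)) :=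
      ((hg.differentiableOn one_ne_zero).differentiableAt
        (hG.mem_nhds (hSG (rotateSphere U (γ s)).2))).hasFDerivAt
    have h3 := h2.comp_hasDerivAt (f := fun s => (U : V →L[ℝ] V) (greatCircle p q s)) s h1
    simp only [φ, inner_gradient_left]
    exact h3
  have hγ0 : γ 0 = p := Subtype.ext (by simp [γ, greatCircle])
  have hγα : γ α = z := Subtype.ext hγz
  have hpt : ∀ U, (g (rotateSphere U z) - g (rotateSphere U p)) ^ 2 ≤
      α * ∫ s in 0..α, φ U s ^ 2 := by
    intro U
    have := intervalIntegral.integral_eq_sub_of_hasDerivAt (a := 0) (b := α)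
      (fun s _ => hderiv U s) ((hφU U).intervalIntegrable _ _)
    rw [hγ0, hγα] at this
    rw [← this]
    exact sq_intervalIntegral_le (hφU U) hα
  have hprod : Integrable (Function.uncurry fun U s => φ U s ^ 2)
      (ν.prod (volume.restrict (Set.Ioc 0 α))) := by
    have h1 : IntegrableOn (Function.uncurry fun U s => φ U s ^ 2)
        (Set.univ ×ˢ Set.Icc 0 α) (ν.prod volume) :=
      ContinuousOn.integrableOn_compact (isCompact_univ.prod isCompact_Icc)
        (hφ.pow 2).continuousOn
    have h2 := h1.mono_set (Set.prod_mono_right Set.Ioc_subset_Icc_self)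
    rwa [IntegrableOn, ← Measure.prod_restrict, Measure.restrict_univ] at h2
  have hgc : Continuous fun x : sphere (0 : V) 1 => g x :=
    hg.continuousOn.comp_continuous continuous_subtype_val fun x => hSG x.2
  have hn : (0 : ℝ) < (Module.finrank ℝ V : ℝ) - 1 := by
    have : (2 : ℝ) ≤ Module.finrank ℝ V := by exact_mod_cast hV
    linarith
  set D := ∫ x : sphere (0 : V) 1, ‖gradient g (x : V)‖ ^ 2 ∂σ
  calc ∫ U, (g (rotateSphere U z) - g (rotateSphere U p)) ^ 2 ∂ν
      ≤ ∫ U, (α * ∫ s in 0..α, φ U s ^ 2) ∂ν := by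
        refine integral_mono ?_ ?_ hpt
        · exact Continuous.integrable_of_hasCompactSupport
            (((hgc.comp (continuous_rotateSphere_left z)).sub
              (hgc.comp (continuous_rotateSphere_left p))).pow 2)
            (HasCompactSupport.of_compactSpace _)
        · simp only [intervalIntegral.integral_of_le hα]
          exact hprod.integral_prod_left.const_mul α
    _ = α * ∫ s in 0..α, ∫ U, φ U s ^ 2 ∂ν := by
        simp only [intervalIntegral.integral_of_le hα, integral_const_mul]
        rw [integral_integral_swap hprod]
    _ ≤ α * ∫ s in 0..α, D / ((Module.finrank ℝ V : ℝ) - 1) := by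
        refine mul_le_mul_of_nonneg_left ?_ hα
        simp only [intervalIntegral.integral_of_le hα]
        refine integral_mono hprod.integral_prod_right (integrable_const _) fun s => ?_
        rw [le_div_iff₀' hn]
        exact mul_integral_haar_inner_sq_le hσ ν hX (γ s)
          (norm_greatCircle hp1 hq hpq _) (inner_greatCircle_add_pi_div_two hp1 hq hpq s)
    _ = _ := by
        rw [intervalIntegral.integral_const, smul_eq_mul]
        ring

/-- A Poincaré inequality on the sphere, with the full gradient on the right. Twice the variance of
`g` is the mean square of `g (U z) - g (U p)` for independent random `U` and `z`. -/
theorem integral_sub_average_sq_le {σ : Measure (sphere (0 : V) 1)} [IsProbabilityMeasure σ]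
    (hσ : ∀ U : unitary (V →L[ℝ] V), MeasurePreserving (rotateSphere U) σ σ)
    (hV : 2 ≤ Module.finrank ℝ V)
    {G : Set V} (hG : IsOpen G) (hSG : sphere (0 : V) 1 ⊆ G)
    {g : V → ℝ} (hg : ContDiffOn ℝ 1 g G) :
    ∫ x : sphere (0 : V) 1, (g x - ∫ y : sphere (0 : V) 1, g y ∂σ) ^ 2 ∂σ
      ≤ Real.pi ^ 2 / 8 * (1 + 1 / Module.finrank ℝ V) *
        ((∫ x : sphere (0 : V) 1, ‖gradient g (x : V)‖ ^ 2 ∂σ) /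
          ((Module.finrank ℝ V : ℝ) - 1)) := by
  obtain ⟨ν, hν, hν'⟩ := exists_rightInvariant_probabilityMeasure (unitary (V →L[ℝ] V))
  obtain ⟨p⟩ : Nonempty (sphere (0 : V) 1) := nonempty_of_isProbabilityMeasure σ
  have hgc : Continuous fun x : sphere (0 : V) 1 => g x :=
    hg.continuousOn.comp_continuous continuous_subtype_val fun x => hSG x.2
  set m := ∫ y : sphere (0 : V) 1, g y ∂σ
  set D := ∫ x : sphere (0 : V) 1, ‖gradient g (x : V)‖ ^ 2 ∂σ
  have hn : (0 : ℝ) < (Module.finrank ℝ V : ℝ) - 1 := by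
    have : (2 : ℝ) ≤ Module.finrank ℝ V := by exact_mod_cast hV
    linarith
  have hD : 0 ≤ D / ((Module.finrank ℝ V : ℝ) - 1) :=
    div_nonneg (integral_nonneg fun x => sq_nonneg _) hn.le
  have hh : Continuous fun x : sphere (0 : V) 1 => (g x - m) ^ 2 :=
    (hgc.sub continuous_const).pow 2
  have hint : ∀ {h : sphere (0 : V) 1 → ℝ}, Continuous h → Integrable h σ := fun hc =>
    hc.integrable_of_hasCompactSupport (HasCompactSupport.of_compactSpace _)
  have hprod : Integrable (Function.uncurry fun (z : sphere (0 : V) 1)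
      (U : unitary (V →L[ℝ] V)) => (g (rotateSphere U z) - g (rotateSphere U p)) ^ 2)
      (σ.prod ν) := by
    refine Continuous.integrable_of_hasCompactSupport ?_ (HasCompactSupport.of_compactSpace _)
    exact ((hgc.comp (continuous_rotateSphere_uncurry.comp continuous_swap)).sub
      (hgc.comp ((continuous_rotateSphere_left p).comp continuous_snd))).pow 2
  have hz : ∀ U : unitary (V →L[ℝ] V),
      ∫ z : sphere (0 : V) 1, (g (rotateSphere U z) - g (rotateSphere U p)) ^ 2 ∂σ =
        (∫ x : sphere (0 : V) 1, (g x - m) ^ 2 ∂σ) + (g (rotateSphere U p) - m) ^ 2 := by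
    intro U
    set c := g (rotateSphere U p)
    rw [integral_rotateSphere_eq hσ (h := fun z : sphere (0 : V) 1 => (g z - c) ^ 2)
      ((hgc.sub continuous_const).pow 2)]
    have h1 : ∀ z : sphere (0 : V) 1,
        (g z - c) ^ 2 = (g z - m) ^ 2 + (2 * (m - c) * (g z - m) + (c - m) ^ 2) := fun z => by ring
    simp only [h1]
    have h2 : Continuous fun z : sphere (0 : V) 1 => 2 * (m - c) * (g z - m) :=
      continuous_const.mul (hgc.sub continuous_const)
    have h3 : Continuous fun z : sphere (0 : V) 1 => 2 * (m - c) * (g z - m) + (c - m) ^ 2 :=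
      h2.add continuous_const
    rw [integral_add (hint hh) (hint h3), integral_add (hint h2)
      (integrable_const _), integral_const_mul, integral_sub (hint hgc) (integrable_const _)]
    simp [m]
  have h2 : 2 * ∫ x : sphere (0 : V) 1, (g x - m) ^ 2 ∂σ ≤
      (∫ z : sphere (0 : V) 1, Real.arccos (inner ℝ (p : V) (z : V)) ^ 2 ∂σ) *
        (D / ((Module.finrank ℝ V : ℝ) - 1)) := by
    have hac : Continuous fun z : sphere (0 : V) 1 =>
        Real.arccos (inner ℝ (p : V) (z : V)) ^ 2 :=
      (Real.continuous_arccos.comp (by fun_prop)).pow 2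
    have := integral_mono hprod.integral_prod_left ((hint hac).mul_const _)
      fun z => integral_haar_sub_sq_le hσ ν hV hG hSG hg p z
    rw [integral_mul_const] at this
    refine le_trans (le_of_eq ?_) this
    simp only [Function.uncurry_apply_pair]
    rw [integral_integral_swap hprod]
    simp only [hz]
    rw [integral_add (integrable_const _), integral_haar_rotateSphere hσ ν hh p, integral_const]
    · simp; ring
    · exact Continuous.integrable_of_hasCompactSupport
        (hh.comp (continuous_rotateSphere_left p)) (HasCompactSupport.of_compactSpace _)
  have h3 := mul_le_mul_of_nonneg_right (integral_arccos_inner_sq_le hσ p) hD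
  linarith

end Geodesics

/-! ### The mean of the gradient -/

section Barycentre

variable {V : Type*} [NormedAddCommGroup V] [InnerProductSpace ℝ V] [FiniteDimensional ℝ V]

/-- The generator `x ↦ ⟪v, x⟫ u - ⟪u, x⟫ v` of the rotations in the plane of `u` and `v`. -/
theorem smulRight_sub_smulRight_mem_skewAdjoint (u v : V) :
    (innerSL ℝ v).smulRight u - (innerSL ℝ u).smulRight v ∈ skewAdjoint (V →L[ℝ] V) := by
  rw [skewAdjoint.mem_iff, ContinuousLinearMap.star_eq_adjoint, eq_comm,
    ContinuousLinearMap.eq_adjoint_iff]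
  intro x y
  simp [inner_sub_left, inner_sub_right, inner_smul_left, inner_smul_right]
  rw [real_inner_comm x u, real_inner_comm x v]
  ring

variable [MeasurableSpace V] [BorelSpace V]

/-- If `f` is orthogonal to all linear functions, then so is its derivative along each rotation
field `θ ↦ A θ`. By invariance, the integral of `f (exp (t A) θ) * ⟪v, θ⟫` is the integral of `f`
against another linear function, hence zero for all `t`; differentiate at `t = 0`. -/
theorem integral_fderiv_skew_mul_inner_eq_zero {σ : Measure (sphere (0 : V) 1)}
    [IsProbabilityMeasure σ]
    (hσ : ∀ U : unitary (V →L[ℝ] V), MeasurePreserving (rotateSphere U) σ σ)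
    {G : Set V} (hG : IsOpen G) (hSG : sphere (0 : V) 1 ⊆ G)
    {f : V → ℝ} (hf : ContDiffOn ℝ 1 f G)
    (horth : ∀ L : V →ₗ[ℝ] ℝ, ∫ θ : sphere (0 : V) 1, f θ * L θ ∂σ = 0)
    {A : V →L[ℝ] V} (hA : A ∈ skewAdjoint (V →L[ℝ] V)) (v : V) :
    ∫ θ : sphere (0 : V) 1, fderiv ℝ f θ (A θ) * inner ℝ v (θ : V) ∂σ = 0 := by
  let _ : NormedAlgebra ℚ (V →L[ℝ] V) := NormedAlgebra.restrictScalars ℚ ℝ _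
  let R : ℝ → unitary (V →L[ℝ] V) := fun t =>
    ⟨NormedSpace.exp (t • A), NormedSpace.exp_mem_unitary_of_mem_skewAdjoint
      (skewAdjoint.smul_mem t hA)⟩
  have hR0 : R 0 = 1 := Subtype.ext (by simp [R])
  have hfc : Continuous fun θ : sphere (0 : V) 1 => f θ :=
    hf.continuousOn.comp_continuous continuous_subtype_val fun x => hSG x.2
  have hX := continuous_gradient_sphere hG hSG hf
  have hY : Continuous fun θ : sphere (0 : V) 1 => fderiv ℝ f θ (A θ) := by
    simp only [← inner_gradient_left]
    exact hX.inner (by fun_prop)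
  have hv : Continuous fun θ : sphere (0 : V) 1 => (inner ℝ v (θ : V) : ℝ) := by fun_prop
  obtain ⟨C, hC⟩ : ∃ C, ∀ θ : sphere (0 : V) 1, ‖fderiv ℝ f θ (A θ)‖ ≤ C := by
    obtain ⟨C, hC⟩ := (isCompact_range hY).isBounded.exists_norm_le
    exact ⟨C, fun θ => hC _ ⟨θ, rfl⟩⟩
  have hzero : ∀ t, ∫ θ : sphere (0 : V) 1,
      f (rotateSphere (R t) θ) * inner ℝ v (θ : V) ∂σ = 0 := by
    intro t
    rw [← horth ((innerSL ℝ v).toLinearMap ∘ₗ (((R t)⁻¹ : unitary (V →L[ℝ] V)) :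
      V →L[ℝ] V).toLinearMap)]
    have hc : Continuous fun θ : sphere (0 : V) 1 =>
        f θ * inner ℝ v (rotateSphere (R t)⁻¹ θ : V) :=
      hfc.mul (continuous_const.inner
        (continuous_subtype_val.comp (continuous_rotateSphere _)))
    refine (integral_congr_ae (Eventually.of_forall fun θ => ?_)).trans
      (integral_rotateSphere_eq hσ hc (R t))
    rw [← rotateSphere_mul, inv_mul_cancel]
    rfl
  have hderiv : ∀ (θ : sphere (0 : V) 1) (t : ℝ),
      HasDerivAt (fun t => f (rotateSphere (R t) θ) * inner ℝ v (θ : V))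
        (fderiv ℝ f (rotateSphere (R t) θ) (A (rotateSphere (R t) θ)) * inner ℝ v (θ : V)) t := by
    intro θ t
    refine HasDerivAt.mul_const ?_ _
    have h1 : HasDerivAt (fun t : ℝ => NormedSpace.exp (t • A) (θ : V))
        (A (NormedSpace.exp (t • A) (θ : V))) t :=
      (hasDerivAt_exp_smul_const' (𝕂 := ℝ) A t).clm_apply (hasDerivAt_const t (θ : V))
        |>.congr_deriv (by simp)
    have h2 : HasFDerivAt f (fderiv ℝ f (rotateSphere (R t) θ)) (rotateSphere (R t) θ) :=
      ((hf.differentiableOn one_ne_zero).differentiableAt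
        (hG.mem_nhds (hSG (rotateSphere (R t) θ).2))).hasFDerivAt
    exact h2.comp_hasDerivAt (f := fun t : ℝ => NormedSpace.exp (t • A) (θ : V)) t h1
  have hint : ∀ {h : sphere (0 : V) 1 → ℝ}, Continuous h → Integrable h σ := fun hc =>
    hc.integrable_of_hasCompactSupport (HasCompactSupport.of_compactSpace _)
  have hcF : ∀ t, Continuous fun θ : sphere (0 : V) 1 =>
      f (rotateSphere (R t) θ) * inner ℝ v (θ : V) := fun t =>
    (hfc.comp (continuous_rotateSphere (R t))).mul hv
  have key := (hasDerivAt_integral_of_dominated_loc_of_deriv_le (μ := σ) (x₀ := (0 : ℝ))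
    (F := fun t θ => f (rotateSphere (R t) θ) * inner ℝ v (θ : V))
    (F' := fun t θ => fderiv ℝ f (rotateSphere (R t) θ) (A (rotateSphere (R t) θ)) *
      inner ℝ v (θ : V)) (bound := fun _ => C * ‖v‖) univ_mem
    (Eventually.of_forall fun t => (hcF t).aestronglyMeasurable) (hint (hcF 0))
    (Continuous.aestronglyMeasurable ((hY.comp (continuous_rotateSphere (R 0))).mul hv))
    (Eventually.of_forall fun θ t _ => ?_) (integrable_const _)
    (Eventually.of_forall fun θ t _ => hderiv θ t)).2
  · simp only [hzero] at key
    have h0 := key.unique (hasDerivAt_const (0 : ℝ) (0 : ℝ))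
    rw [hR0] at h0
    exact h0
  · rw [norm_mul]
    refine mul_le_mul (hC _) ?_ (norm_nonneg _) ((norm_nonneg _).trans (hC θ))
    simpa using norm_inner_le_norm (𝕜 := ℝ) v (θ : V)

/-- If `f` is orthogonal to all linear functions, then the tangential part of `∇f` has mean zero. -/
theorem integral_inner_gradient_eq {σ : Measure (sphere (0 : V) 1)}
    [IsProbabilityMeasure σ]
    (hσ : ∀ U : unitary (V →L[ℝ] V), MeasurePreserving (rotateSphere U) σ σ)
    {G : Set V} (hG : IsOpen G) (hSG : sphere (0 : V) 1 ⊆ G)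
    {f : V → ℝ} (hf : ContDiffOn ℝ 1 f G)
    (horth : ∀ L : V →ₗ[ℝ] ℝ, ∫ θ : sphere (0 : V) 1, f θ * L θ ∂σ = 0) (u : V) :
    ∫ θ : sphere (0 : V) 1, inner ℝ (gradient f (θ : V)) u ∂σ =
      ∫ θ : sphere (0 : V) 1, inner ℝ u (θ : V) * inner ℝ (gradient f (θ : V)) (θ : V) ∂σ := by
  have hX := continuous_gradient_sphere hG hSG hf
  have hint : ∀ {h : sphere (0 : V) 1 → ℝ}, Continuous h → Integrable h σ := fun hc =>
    hc.integrable_of_hasCompactSupport (HasCompactSupport.of_compactSpace _)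
  let b := stdOrthonormalBasis ℝ V
  have hterm : ∀ i, ∫ θ : sphere (0 : V) 1,
      (inner ℝ (b i) (θ : V) * inner ℝ (gradient f (θ : V)) u -
        inner ℝ u (θ : V) * inner ℝ (gradient f (θ : V)) (b i)) * inner ℝ (b i) (θ : V) ∂σ = 0 := by
    intro i
    rw [← integral_fderiv_skew_mul_inner_eq_zero hσ hG hSG hf horth
      (smulRight_sub_smulRight_mem_skewAdjoint u (b i)) (b i)]
    refine integral_congr_ae (Eventually.of_forall fun θ => ?_)
    simp
  have hc : ∀ i, Continuous fun θ : sphere (0 : V) 1 =>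
      (inner ℝ (b i) (θ : V) * inner ℝ (gradient f (θ : V)) u -
        inner ℝ u (θ : V) * inner ℝ (gradient f (θ : V)) (b i)) * inner ℝ (b i) (θ : V) := by
    intro i; fun_prop
  have hsum := Finset.sum_eq_zero fun i (_ : i ∈ Finset.univ) => hterm i
  rw [← integral_finsetSum _ fun i _ => hint (hc i)] at hsum
  rw [← sub_eq_zero, ← integral_sub (hint (by fun_prop)) (hint (by fun_prop)), ← hsum]
  refine integral_congr_ae (Eventually.of_forall fun θ => ?_)
  have h1 : ∑ i, (inner ℝ (b i) (θ : V)) ^ 2 = 1 := by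
    rw [b.sum_sq_inner_right]; simp
  have h2 : ∑ i, inner ℝ (gradient f (θ : V)) (b i) * inner ℝ (b i) (θ : V) =
      inner ℝ (gradient f (θ : V)) (θ : V) := b.sum_inner_mul_inner _ _
  have h3 : inner ℝ (gradient f (θ : V)) u - inner ℝ u (θ : V) *
      inner ℝ (gradient f (θ : V)) (θ : V) =
      inner ℝ (gradient f (θ : V)) u * ∑ i, (inner ℝ (b i) (θ : V)) ^ 2 - inner ℝ u (θ : V) *
        ∑ i, inner ℝ (gradient f (θ : V)) (b i) * inner ℝ (b i) (θ : V) := by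
    rw [h1, h2, mul_one]
  refine h3.trans ?_
  rw [Finset.mul_sum, Finset.mul_sum, ← Finset.sum_sub_distrib]
  exact Finset.sum_congr rfl fun i _ => by ring

/-- The mean `a` of `∇f` is controlled by the variance of `∇f`. Since `‖a‖ ^ 2` is the integral of
`⟪a, θ⟫ * ⟪∇f, θ⟫`, and replacing `∇f` by `a` in it gives only `‖a‖ ^ 2 / n`, the difference
`(1 - 1 / n) * ‖a‖ ^ 2` is the integral of `⟪∇f - a, ⟪a, θ⟫ θ - a / n⟫`, where both factors have
mean zero. -/
theorem norm_sq_integral_gradient_le {σ : Measure (sphere (0 : V) 1)}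
    [IsProbabilityMeasure σ]
    (hσ : ∀ U : unitary (V →L[ℝ] V), MeasurePreserving (rotateSphere U) σ σ)
    (hV : 2 ≤ Module.finrank ℝ V)
    {G : Set V} (hG : IsOpen G) (hSG : sphere (0 : V) 1 ⊆ G)
    {f : V → ℝ} (hf : ContDiffOn ℝ 1 f G)
    (horth : ∀ L : V →ₗ[ℝ] ℝ, ∫ θ : sphere (0 : V) 1, f θ * L θ ∂σ = 0) :
    ((Module.finrank ℝ V : ℝ) - 1) * ‖∫ θ : sphere (0 : V) 1, gradient f (θ : V) ∂σ‖ ^ 2 ≤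
      ∫ θ : sphere (0 : V) 1,
        ‖gradient f (θ : V) - ∫ θ : sphere (0 : V) 1, gradient f (θ : V) ∂σ‖ ^ 2 ∂σ := by
  have hX := continuous_gradient_sphere hG hSG hf
  have hint : ∀ {h : sphere (0 : V) 1 → ℝ}, Continuous h → Integrable h σ := fun hc =>
    hc.integrable_of_hasCompactSupport (HasCompactSupport.of_compactSpace _)
  have hXi : Integrable (fun θ : sphere (0 : V) 1 => gradient f (θ : V)) σ :=
    hX.integrable_of_hasCompactSupport (HasCompactSupport.of_compactSpace _)
  set a := ∫ θ : sphere (0 : V) 1, gradient f (θ : V) ∂σ with ha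
  set n : ℝ := (Module.finrank ℝ V : ℝ) with hn
  have hn2 : 2 ≤ n := by rw [hn]; exact_mod_cast hV
  have hn0 : 0 < n := by linarith
  have hmean : ∫ θ : sphere (0 : V) 1, inner ℝ (gradient f (θ : V)) a ∂σ = ‖a‖ ^ 2 := by
    simp only [real_inner_comm a]
    rw [integral_inner hXi, real_inner_self_eq_norm_sq]
  have hrad := (integral_inner_gradient_eq hσ hG hSG hf horth a).symm.trans hmean
  have hmom := integral_inner_sq_sphere hσ a
  -- Young's inequality; the weight `1 / n` makes the `‖a‖ ^ 2` on the right after integration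
  -- half of that on the left, which is the optimal choice.
  have hpt : ∀ θ : sphere (0 : V) 1,
      inner ℝ a (θ : V) * inner ℝ (gradient f (θ : V)) (θ : V) - inner ℝ a (θ : V) ^ 2
        - (1 / n) * (inner ℝ (gradient f (θ : V)) a - ‖a‖ ^ 2) ≤
      1 / (2 * n) * ‖gradient f (θ : V) - a‖ ^ 2 +
        ((n / 2 - 1) * inner ℝ a (θ : V) ^ 2 + ‖a‖ ^ 2 / (2 * n)) := by
    intro θ
    set X := gradient f (θ : V)
    have h1 : inner ℝ (X - a) ((inner ℝ a (θ : V) : ℝ) • (θ : V) - (1 / n) • a) =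
        inner ℝ a (θ : V) * inner ℝ X (θ : V) - inner ℝ a (θ : V) ^ 2
        - (1 / n) * (inner ℝ X a - ‖a‖ ^ 2) := by
      simp only [inner_sub_left, inner_sub_right, inner_smul_right, real_inner_self_eq_norm_sq]
      ring
    have h2 : ‖(inner ℝ a (θ : V) : ℝ) • (θ : V) - (1 / n) • a‖ ^ 2 =
        (1 - 2 / n) * inner ℝ a (θ : V) ^ 2 + ‖a‖ ^ 2 / n ^ 2 := by
      rw [norm_sub_sq_real, norm_smul, norm_smul, inner_smul_left, inner_smul_right,
        real_inner_comm, norm_eq_of_mem_sphere, mul_one, mul_pow, Real.norm_eq_abs,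
        Real.norm_eq_abs, sq_abs, sq_abs]
      simp only [conj_trivial]
      ring
    rw [← h1]
    set Y := (inner ℝ a (θ : V) : ℝ) • (θ : V) - (1 / n) • a
    have h3 : 1 / (2 * n) * ‖X - a‖ ^ 2 + ((n / 2 - 1) * inner ℝ a (θ : V) ^ 2 +
        ‖a‖ ^ 2 / (2 * n)) = 1 / (2 * n) * ‖X - a‖ ^ 2 + n / 2 * ‖Y‖ ^ 2 := by
      rw [h2]; field_simp
    rw [h3]
    refine (real_inner_le_norm _ _).trans ?_
    have h4 : 1 / (2 * n) * ‖X - a‖ ^ 2 + n / 2 * ‖Y‖ ^ 2 - ‖X - a‖ * ‖Y‖ =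
        1 / (2 * n) * (‖X - a‖ - n * ‖Y‖) ^ 2 := by
      field_simp; ring
    have : 0 ≤ 1 / (2 * n) * (‖X - a‖ - n * ‖Y‖) ^ 2 := by positivity
    linarith
  have hle := integral_mono (hint (by fun_prop)) (hint (by fun_prop)) hpt
  rw [integral_sub (hint (by fun_prop)) (hint (by fun_prop)),
    integral_sub (hint (by fun_prop)) (hint (by fun_prop)),
    integral_add (hint (by fun_prop)) (hint (by fun_prop)),
    integral_add (hint (by fun_prop)) (hint (by fun_prop)),
    integral_const_mul, integral_const_mul, integral_const_mul,
    integral_sub (hint (by fun_prop)) (hint (by fun_prop)), hrad, hmom, hmean] at hle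
  simp only [integral_const, probReal_univ, one_smul, sub_self, mul_zero, sub_zero] at hle
  set W := ∫ θ : sphere (0 : V) 1, ‖gradient f (θ : V) - a‖ ^ 2 ∂σ
  have h5 : ‖a‖ ^ 2 - ‖a‖ ^ 2 / n - ((n / 2 - 1) * (‖a‖ ^ 2 / n) + ‖a‖ ^ 2 / (2 * n)) =
      1 / (2 * n) * ((n - 1) * ‖a‖ ^ 2) := by
    field_simp; ring
  have h6 : 1 / (2 * n) * ((n - 1) * ‖a‖ ^ 2) ≤ 1 / (2 * n) * W := by linarith
  exact le_of_mul_le_mul_left h6 (by positivity)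

end Barycentre

/-! ### The gradient and the Hessian in coordinates -/

theorem measurePreserving_rotateSphere_sphereUniform (n : ℕ)
    (U : unitary (EuclideanSpace ℝ (Fin n) →L[ℝ] EuclideanSpace ℝ (Fin n))) :
    MeasurePreserving (rotateSphere U) (sphereUniform n) (sphereUniform n) :=
  (measurePreserving_rotateSphere_toSphere U).smul_measure _

theorem gradient_apply_eq_fderiv_single {n : ℕ} (g : EuclideanSpace ℝ (Fin n) → ℝ)
    (x : EuclideanSpace ℝ (Fin n)) (j : Fin n) :
    gradient g x j = fderiv ℝ g x (EuclideanSpace.single j 1) := by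
  rw [← inner_gradient_left, EuclideanSpace.inner_single_right]
  simp

/-- The columns of the Hessian matrix are the gradients of the first partial derivatives. -/
theorem norm_hessianMatrix_sq {n : ℕ} (f : EuclideanSpace ℝ (Fin n) → ℝ)
    (x : EuclideanSpace ℝ (Fin n)) :
    ‖hessianMatrix f x‖ ^ 2 =
      ∑ j, ‖gradient (fun y => fderiv ℝ f y (EuclideanSpace.single j 1)) x‖ ^ 2 := by
  rw [Matrix.frobenius_norm_def, ← Real.sqrt_eq_rpow, Real.sq_sqrt (by positivity),
    Finset.sum_comm]
  refine Finset.sum_congr rfl fun j _ => ?_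
  rw [EuclideanSpace.real_norm_sq_eq]
  refine Finset.sum_congr rfl fun i _ => ?_
  rw [gradient_apply_eq_fderiv_single]
  simp [hessianMatrix]

/-- The Poincaré inequality for each partial derivative of `f`, summed. -/
theorem integral_norm_gradient_sub_average_sq_le {n : ℕ} (hn : 2 ≤ n)
    {σ : Measure (sphere (0 : EuclideanSpace ℝ (Fin n)) 1)} [IsProbabilityMeasure σ]
    (hσ : ∀ U : unitary (EuclideanSpace ℝ (Fin n) →L[ℝ] EuclideanSpace ℝ (Fin n)),
      MeasurePreserving (rotateSphere U) σ σ)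
    {G : Set (EuclideanSpace ℝ (Fin n))} (hG : IsOpen G)
    (hSG : sphere (0 : EuclideanSpace ℝ (Fin n)) 1 ⊆ G)
    {f : EuclideanSpace ℝ (Fin n) → ℝ} (hf : ContDiffOn ℝ 2 f G) :
    ∫ θ : sphere (0 : EuclideanSpace ℝ (Fin n)) 1, ‖gradient f θ -
        ∫ x : sphere (0 : EuclideanSpace ℝ (Fin n)) 1, gradient f x ∂σ‖ ^ 2 ∂σ ≤
      Real.pi ^ 2 / 8 * (1 + 1 / n) / ((n : ℝ) - 1) *
        ∫ θ : sphere (0 : EuclideanSpace ℝ (Fin n)) 1, ‖hessianMatrix f θ‖ ^ 2 ∂σ := by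
  let g : Fin n → EuclideanSpace ℝ (Fin n) → ℝ := fun j y =>
    fderiv ℝ f y (EuclideanSpace.single j 1)
  have hg : ∀ j, ContDiffOn ℝ 1 (g j) G := fun j =>
    (hf.fderiv_of_isOpen hG (by norm_num)).clm_apply contDiffOn_const
  have hX := continuous_gradient_sphere hG hSG (hf.of_le one_le_two)
  have hXi : Integrable (fun θ : sphere (0 : EuclideanSpace ℝ (Fin n)) 1 => gradient f θ) σ :=
    hX.integrable_of_hasCompactSupport (HasCompactSupport.of_compactSpace _)
  have hint : ∀ {h : sphere (0 : EuclideanSpace ℝ (Fin n)) 1 → ℝ}, Continuous h →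
      Integrable h σ := fun hc =>
    hc.integrable_of_hasCompactSupport (HasCompactSupport.of_compactSpace _)
  set a := ∫ x : sphere (0 : EuclideanSpace ℝ (Fin n)) 1, gradient f x ∂σ
  have ha : ∀ j, a j = ∫ x : sphere (0 : EuclideanSpace ℝ (Fin n)) 1, g j x ∂σ := by
    intro j
    have := (EuclideanSpace.proj (𝕜 := ℝ) j).integral_comp_comm hXi
    simpa [gradient_apply_eq_fderiv_single] using! this.symm
  have hcoord : ∀ θ : sphere (0 : EuclideanSpace ℝ (Fin n)) 1,
      ‖gradient f θ - a‖ ^ 2 =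
        ∑ j, (g j θ - ∫ x : sphere (0 : EuclideanSpace ℝ (Fin n)) 1, g j x ∂σ) ^ 2 := by
    intro θ
    rw [EuclideanSpace.real_norm_sq_eq]
    refine Finset.sum_congr rfl fun j _ => ?_
    rw [PiLp.sub_apply, gradient_apply_eq_fderiv_single, ha]
  have hgc : ∀ j, Continuous fun x : sphere (0 : EuclideanSpace ℝ (Fin n)) 1 => g j x := fun j =>
    (hg j).continuousOn.comp_continuous continuous_subtype_val fun x => hSG x.2
  have hgv : ∀ j, Continuous fun x : sphere (0 : EuclideanSpace ℝ (Fin n)) 1 =>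
      (g j x - ∫ y : sphere (0 : EuclideanSpace ℝ (Fin n)) 1, g j y ∂σ) ^ 2 := fun j =>
    ((hgc j).sub continuous_const).pow 2
  have hgn : ∀ j, Continuous fun x : sphere (0 : EuclideanSpace ℝ (Fin n)) 1 =>
      ‖gradient (fun y => fderiv ℝ f y (EuclideanSpace.single j 1)) (x : EuclideanSpace ℝ _)‖ ^ 2 :=
    fun j => (continuous_gradient_sphere hG hSG (hg j)).norm.pow 2
  simp only [hcoord, norm_hessianMatrix_sq]
  rw [integral_finsetSum _ fun j _ => hint (hgv j), integral_finsetSum _ fun j _ => hint (hgn j),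
    Finset.mul_sum]
  refine Finset.sum_le_sum fun j _ => ?_
  refine (integral_sub_average_sq_le hσ (by simpa using hn) hG hSG (hg j)).trans_eq ?_
  rw [finrank_euclideanSpace_fin]
  ring

/-! ### The constants and the final estimate -/

/-- With `s = 1 / √(n - 1) ≤ 1`, the left side is at most `(5 / 4) * (1 + s ^ 2) ^ 2`, because
`π ^ 2 < 10` and `1 / n ≤ s ^ 2`. -/
theorem poincareConst_mul_le_gradientConst {n : ℕ} (hn : 2 ≤ n) :
    (1 + 1 / ((n : ℝ) - 1)) * (Real.pi ^ 2 / 8 * (1 + 1 / n)) ≤ gradientConst n := by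
  have hn' : (2 : ℝ) ≤ n := by exact_mod_cast hn
  set m : ℝ := (n : ℝ) - 1 with hm
  have hm1 : 1 ≤ m := by linarith
  set s := 1 / √m with hs
  have hs0 : 0 ≤ s := by positivity
  have hs1 : s ≤ 1 := by
    rw [hs, div_le_one (by positivity)]
    exact Real.one_le_sqrt.2 hm1
  have hs2 : 1 / m = s ^ 2 := by
    rw [hs, div_pow, Real.sq_sqrt (by linarith), one_pow]
  have hsn : 1 / (n : ℝ) ≤ s ^ 2 := by
    rw [← hs2]
    exact one_div_le_one_div_of_le (by linarith) (by linarith)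
  have hpi : Real.pi ^ 2 / 8 ≤ 5 / 4 := by
    nlinarith [Real.pi_lt_d2, Real.pi_pos]
  have hss : s ^ 2 ≤ s := by nlinarith
  have hss4 : s ^ 4 ≤ s := by nlinarith [sq_nonneg s, sq_nonneg (s ^ 2)]
  rw [hs2, gradientConst]
  calc (1 + s ^ 2) * (Real.pi ^ 2 / 8 * (1 + 1 / n))
      ≤ (1 + s ^ 2) * (5 / 4 * (1 + s ^ 2)) := by gcongr
    _ ≤ 1 + (1 + s) ^ 2 := by nlinarith

theorem gradientConst_le_five {n : ℕ} (hn : 2 ≤ n) : gradientConst n ≤ 5 := by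
  have hn' : (2 : ℝ) ≤ n := by exact_mod_cast hn
  have h1 : 1 / √((n : ℝ) - 1) ≤ 1 := by
    have h2 : 1 ≤ √((n : ℝ) - 1) := Real.one_le_sqrt.2 (by linarith)
    rwa [div_le_one (by linarith)]
  have h3 : 0 ≤ 1 / √((n : ℝ) - 1) := by positivity
  rw [gradientConst]
  nlinarith

theorem tendsto_gradientConst : Tendsto gradientConst atTop (𝓝 2) := by
  have h1 : Tendsto (fun n : ℕ => (n : ℝ) - 1) atTop atTop :=
    tendsto_atTop_add_const_right _ _ tendsto_natCast_atTop_atTop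
  have h2 : Tendsto (fun n : ℕ => 1 / √((n : ℝ) - 1)) atTop (𝓝 0) :=
    (Real.tendsto_sqrt_atTop.comp h1).const_div_atTop 1
  have h3 := ((h2.const_add 1).pow 2).const_add 1
  norm_num at h3
  exact h3.congr fun n => by simp [gradientConst]

/-- The inequality with the constant `gradientConst n`, for any rotation invariant probability
measure on the sphere. -/
theorem integral_norm_gradient_sq_le {n : ℕ} (hn : 2 ≤ n)
    {σ : Measure (sphere (0 : EuclideanSpace ℝ (Fin n)) 1)} [IsProbabilityMeasure σ]
    (hσ : ∀ U : unitary (EuclideanSpace ℝ (Fin n) →L[ℝ] EuclideanSpace ℝ (Fin n)),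
      MeasurePreserving (rotateSphere U) σ σ)
    {G : Set (EuclideanSpace ℝ (Fin n))} (hG : IsOpen G)
    (hSG : sphere (0 : EuclideanSpace ℝ (Fin n)) 1 ⊆ G)
    {f : EuclideanSpace ℝ (Fin n) → ℝ} (hf : ContDiffOn ℝ 2 f G)
    (horth : ∀ L : EuclideanSpace ℝ (Fin n) →ₗ[ℝ] ℝ,
      ∫ θ : sphere (0 : EuclideanSpace ℝ (Fin n)) 1, f θ * L θ ∂σ = 0) :
    ∫ θ : sphere (0 : EuclideanSpace ℝ (Fin n)) 1, ‖gradient f θ‖ ^ 2 ∂σ ≤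
      gradientConst n / ((n : ℝ) - 1) *
        ∫ θ : sphere (0 : EuclideanSpace ℝ (Fin n)) 1, ‖hessianMatrix f θ‖ ^ 2 ∂σ := by
  have hf1 := hf.of_le one_le_two
  have hX := continuous_gradient_sphere hG hSG hf1
  have hXi : Integrable (fun θ : sphere (0 : EuclideanSpace ℝ (Fin n)) 1 => gradient f θ) σ :=
    hX.integrable_of_hasCompactSupport (HasCompactSupport.of_compactSpace _)
  have hint : ∀ {h : sphere (0 : EuclideanSpace ℝ (Fin n)) 1 → ℝ}, Continuous h →
      Integrable h σ := fun hc =>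
    hc.integrable_of_hasCompactSupport (HasCompactSupport.of_compactSpace _)
  have hvar := integral_norm_gradient_sub_average_sq_le hn hσ hG hSG hf
  have hbar := norm_sq_integral_gradient_le hσ (by simpa using hn) hG hSG hf1 horth
  rw [finrank_euclideanSpace_fin] at hbar
  set a := ∫ x : sphere (0 : EuclideanSpace ℝ (Fin n)) 1, gradient f x ∂σ
  have hsplit : ∫ θ : sphere (0 : EuclideanSpace ℝ (Fin n)) 1, ‖gradient f θ‖ ^ 2 ∂σ =
      (∫ θ : sphere (0 : EuclideanSpace ℝ (Fin n)) 1, ‖gradient f θ - a‖ ^ 2 ∂σ) + ‖a‖ ^ 2 := by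
    have h1 : ∀ θ : sphere (0 : EuclideanSpace ℝ (Fin n)) 1, ‖gradient f θ‖ ^ 2 =
        ‖gradient f θ - a‖ ^ 2 + (2 * inner ℝ a (gradient f θ) - ‖a‖ ^ 2) := by
      intro θ
      rw [norm_sub_sq_real, real_inner_comm]
      ring
    simp only [h1]
    rw [integral_add (hint (by fun_prop)) (hint (by fun_prop)),
      integral_sub (hint (by fun_prop)) (hint (by fun_prop)), integral_const_mul,
      integral_inner hXi, real_inner_self_eq_norm_sq]
    simp
    ring
  rw [hsplit]
  set W := ∫ θ : sphere (0 : EuclideanSpace ℝ (Fin n)) 1, ‖gradient f θ - a‖ ^ 2 ∂σ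
  set H := ∫ θ : sphere (0 : EuclideanSpace ℝ (Fin n)) 1, ‖hessianMatrix f θ‖ ^ 2 ∂σ
  have hH : 0 ≤ H := integral_nonneg fun θ => sq_nonneg _
  have hm : (0 : ℝ) < (n : ℝ) - 1 := by
    have : (2 : ℝ) ≤ n := by exact_mod_cast hn
    linarith
  calc W + ‖a‖ ^ 2 ≤ W + W / ((n : ℝ) - 1) := by
        gcongr
        rwa [le_div_iff₀' hm]
    _ = (1 + 1 / ((n : ℝ) - 1)) * W := by ring
    _ ≤ (1 + 1 / ((n : ℝ) - 1)) *
        (Real.pi ^ 2 / 8 * (1 + 1 / n) / ((n : ℝ) - 1) * H) := by gcongr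
    _ = (1 + 1 / ((n : ℝ) - 1)) * (Real.pi ^ 2 / 8 * (1 + 1 / n)) / ((n : ℝ) - 1) * H := by ring
    _ ≤ gradientConst n / ((n : ℝ) - 1) * H := by
        gcongr
        exact poincareConst_mul_le_gradientConst hn

theorem proposition6p1 (n : ℕ) (hn : 2 ≤ n)
    (G : Set (EuclideanSpace ℝ (Fin n))) (hG : IsOpen G)
    (hSG : Metric.sphere (0 : EuclideanSpace ℝ (Fin n)) 1 ⊆ G)
    (f : EuclideanSpace ℝ (Fin n) → ℝ) (hf : ContDiffOn ℝ 2 f G)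
    (horth : ∀ L : EuclideanSpace ℝ (Fin n) →ₗ[ℝ] ℝ,
      ∫ θ : Metric.sphere (0 : EuclideanSpace ℝ (Fin n)) 1, f θ * L θ ∂(sphereUniform n) = 0) :
    (∫ θ : Metric.sphere (0 : EuclideanSpace ℝ (Fin n)) 1, ‖gradient f θ‖ ^ 2 ∂(sphereUniform n)
      ≤ 5 / ((n : ℝ) - 1) *
        ∫ θ : Metric.sphere (0 : EuclideanSpace ℝ (Fin n)) 1,
          ‖hessianMatrix f θ‖ ^ 2 ∂(sphereUniform n)) ∧
    (∫ θ : Metric.sphere (0 : EuclideanSpace ℝ (Fin n)) 1, ‖gradient f θ‖ ^ 2 ∂(sphereUniform n)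
      ≤ gradientConst n / ((n : ℝ) - 1) *
        ∫ θ : Metric.sphere (0 : EuclideanSpace ℝ (Fin n)) 1,
          ‖hessianMatrix f θ‖ ^ 2 ∂(sphereUniform n)) ∧
    Tendsto gradientConst atTop (𝓝 2) := by
  have := isProbabilityMeasure_sphereUniform n (by omega)
  have key := integral_norm_gradient_sq_le hn
    (measurePreserving_rotateSphere_sphereUniform n) hG hSG hf horth
  refine ⟨key.trans ?_, key, tendsto_gradientConst⟩
  have hm : (0 : ℝ) ≤ (n : ℝ) - 1 := by
    have : (2 : ℝ) ≤ n := by exact_mod_cast hn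
    linarith
  refine mul_le_mul_of_nonneg_right ?_ (integral_nonneg fun θ => sq_nonneg _)
  gcongr
  exact gradientConst_le_five hn
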